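/- For a measurable space $S$ let $\mathbb{S}(S)$ be the set of subprobability measures on $S$, with the $\sigma$-algebra $w(S)$ generated by the evaluations $\mu\mapsto\mu(A)$, $A\subseteq S$ measurable; a measurable map $f:S\to T$ induces $\mathbb{S}f:\mathbb{S}(S)\to\mathbb{S}(T)$, $(\mathbb{S}f)(\mu)(B)=\mu(f^{-1}[B])$. A (stochastic) effectivity function on $S$ is a map $P$ that assigns to every $s\in S$ a family $P(s)\subseteq w(S)$ which is upper closed (if $A\in P(s)$, $A\subseteq B$ and $B\in w(S)$, then $B\in P(s)$), and which is t-measurable: for every measurable $H\subseteq\mathbb{S}(S)\times[0,1]$ the set $\{(s,q)\in S\times[0,1] : \{\mu : (\mu,q)\in H\}\in P(s)\}$ is measurable in $S\times[0,1]$. Let $P$ and $Q$ be effectivity functions on $S$ and $T$. A strong morphism from $P$ to $Q$ is a surjective measurable map $f:S\to T$ such that for all $s\in S$ and $A\in w(S)$, $$A\in P(s)\iff (\mathbb{S}f)^{-1}[B]\subseteq A\text{ for some }B\in Q(f(s)).$$ The direct sum $P\oplus Q$ is the effectivity function on the disjoint union $S\oplus T$ that equals $P$ on $S$ and $Q$ on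 $T$, where subprobabilities on a summand are regarded as subprobabilities on $S\oplus T$ via the inclusions $i_S,i_T$; precisely, $(P\oplus Q)(s)=\{W\in w(S\oplus T) : (\mathbb{S}i_S)^{-1}[W]\in P(s)\}$ for $s\in S$ and $(P\oplus Q)(t)=\{W\in w(S\oplus T) : (\mathbb{S}i_T)^{-1}[W]\in Q(t)\}$ for $t\in T$. For a relation $R$ on a measurable space $X$, a set $C\subseteq X$ is $R$-closed if $x\in C$ and $x\mathrel{R}y$ imply $y\in C$, and for $\mu,\nu\in\mathbb{S}(X)$ write $\mu\mathrel{\bar R}\nu$ if $\mu(C)=\nu(C)$ for every measurable $R$-closed $C$. The relation $R$ is a state bisimulation on an effectivity function $P$ on $X$ if it is symmetric and, whenever $x\mathrel{R}y$, for each $A\in P(x)$ there is $B\in P(y)$ such that for every $\nu\in B$ there is $\mu\in A$ with $\mu\mathrel{\bar R}\nu$. **Theorem.** Let $S$ and $T$ be standard Borel spaces, let $P$ and $Q$ be effectivity functions on $S$ and $T$, respectively, and let $f$ be a strong morphism from $P$ to $Q$. Let $G=\{(s,f(s)) : s\in S\}$ be the graph of $f$, regarded as a relation on $S\oplus T$,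 and let $G^{\smallsmile}$ be its converse. Then $R:=G\cup G^{\smallsmile}$ is a state bisimulation on $P\oplus Q$. -/

import Mathlib

open MeasureTheory Set

namespace StochEff

universe u v

/-- The set of all subprobability measures on a measurable space `S`. -/
def SubProb (S : Type u) [MeasurableSpace S] : Type u :=
  {μ : Measure S // μ univ ≤ 1}

/-- The weak-star sigma-algebra on `SubProb S`: the smallest one that makes all evaluations
`μ ↦ μ A`, for `A` measurable, measurable (the trace of Mathlib's sigma-algebra on `Measure S`). -/
instance SubProb.instMeasurableSpace (S : Type u) [MeasurableSpace S] :
    MeasurableSpace (SubProb S) :=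
  inferInstanceAs (MeasurableSpace {μ : Measure S // μ univ ≤ 1})

/-- The image measure of a subprobability under a measurable map. -/
noncomputable def SubProb.map {S : Type u} {T : Type v} [MeasurableSpace S] [MeasurableSpace T]
    (f : S → T) (hf : Measurable f) (μ : SubProb S) : SubProb T :=
  ⟨μ.1.map f, by
    rw [Measure.map_apply hf MeasurableSet.univ, preimage_univ]
    exact μ.2⟩

theorem SubProb.measurable_map {S : Type u} {T : Type v} [MeasurableSpace S] [MeasurableSpace T]
    (f : S → T) (hf : Measurable f) : Measurable (SubProb.map f hf) :=
  ((Measure.measurable_map f hf).comp measurable_subtype_coe).subtype_mk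

/-- `V` is an upper closed family of measurable sets of subprobabilities on `T`: all members are
measurable, and measurable supersets of members are members. -/
def IsUpperFamily {T : Type v} [MeasurableSpace T] (V : Set (Set (SubProb T))) : Prop :=
  (∀ A ∈ V, MeasurableSet A) ∧
    ∀ A B : Set (SubProb T), A ∈ V → A ⊆ B → MeasurableSet B → B ∈ V

/-- The family of all measurable `W` whose preimage under the image measure map of `f` lies
in `V`. -/
def mapFamily {S : Type u} {T : Type v} [MeasurableSpace S] [MeasurableSpace T]
    (f : S → T) (hf : Measurable f) (V : Set (Set (SubProb S))) : Set (Set (SubProb T)) :=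
  {W | MeasurableSet W ∧ SubProb.map f hf ⁻¹' W ∈ V}

theorem IsUpperFamily.mapFamily {S : Type u} {T : Type v} [MeasurableSpace S] [MeasurableSpace T]
    {f : S → T} {hf : Measurable f} {V : Set (Set (SubProb S))} (hV : IsUpperFamily V) :
    IsUpperFamily (mapFamily f hf V) :=
  ⟨fun _ hA => hA.1, fun _ _ hA hAB hB =>
    ⟨hB, hV.2 _ _ hA.2 (preimage_mono hAB) (SubProb.measurable_map f hf hB)⟩⟩

/-- `P` is t-measurable: for every measurable `H ⊆ SubProb T × [0,1]`, the set of all `(s, q)`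
such that the section `{μ | (μ, q) ∈ H}` lies in `P s` is measurable in `S × [0,1]`. -/
def IsTMeasurable {S : Type u} {T : Type v} [MeasurableSpace S] [MeasurableSpace T]
    (P : S → Set (Set (SubProb T))) : Prop :=
  ∀ H : Set (SubProb T × unitInterval), MeasurableSet H →
    MeasurableSet {p : S × unitInterval | {μ : SubProb T | (μ, p.2) ∈ H} ∈ P p.1}

/-- A stochastic effectivity function from `S` to `T`. -/
structure EffFun (S : Type u) (T : Type v) [MeasurableSpace S] [MeasurableSpace T] where
  /-- the portfolio at a state -/
  portfolio : S → Set (Set (SubProb T))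
  upper : ∀ s, IsUpperFamily (portfolio s)
  tMeasurable : IsTMeasurable portfolio

/-- The portfolios of the direct sum. A subprobability on a summand is regarded as one on
`S ⊕ T` through its image measure under the inclusion, and the portfolio at `s : S` is the upper
closed family that `P s` generates among the measurable sets of subprobabilities on `S ⊕ T`
(see `mem_mapFamily_iff`). -/
def sumPortfolio {S : Type u} {T : Type v} [MeasurableSpace S] [MeasurableSpace T]
    (P : EffFun S S) (Q : EffFun T T) : S ⊕ T → Set (Set (SubProb (S ⊕ T))) :=
  Sum.elim (fun s => mapFamily Sum.inl measurable_inl (P.portfolio s))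
    (fun t => mapFamily Sum.inr measurable_inr (Q.portfolio t))

theorem mem_mapFamily_iff {S : Type u} {T : Type v} [MeasurableSpace S] [MeasurableSpace T]
    {f : S → T} {hf : Measurable f} {V : Set (Set (SubProb S))} (hV : IsUpperFamily V)
    (W : Set (SubProb T)) :
    W ∈ mapFamily f hf V ↔ MeasurableSet W ∧ ∃ A ∈ V, SubProb.map f hf '' A ⊆ W :=
  and_congr_right fun hW =>
    ⟨fun h => ⟨_, h, image_preimage_subset _ _⟩, fun ⟨_, hA, h⟩ =>
      hV.2 _ _ hA (image_subset_iff.1 h) (SubProb.measurable_map f hf hW)⟩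

/-- Postcomposing with an image measure map keeps t-measurability. -/
theorem IsTMeasurable.mapFamily {S : Type u} {T : Type v} [MeasurableSpace S] [MeasurableSpace T]
    {P : S → Set (Set (SubProb S))} (hP : IsTMeasurable P) {f : S → T} {hf : Measurable f} :
    IsTMeasurable fun s => mapFamily f hf (P s) := by
  intro H hH
  have hm : Measurable (Prod.map (SubProb.map f hf) (id : unitInterval → unitInterval)) :=
    (SubProb.measurable_map f hf).prodMap measurable_id
  convert hP _ (hm hH) using 1
  ext ⟨s, q⟩
  have hq : MeasurableSet {ν : SubProb T | (ν, q) ∈ H} := measurable_prodMk_right hH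
  exact ⟨fun h => h.2, fun h => ⟨hq, h⟩⟩

theorem isTMeasurable_sumPortfolio {S : Type u} {T : Type v} [MeasurableSpace S]
    [MeasurableSpace T] (P : EffFun S S) (Q : EffFun T T) :
    IsTMeasurable (sumPortfolio P Q) := by
  intro H hH
  have h1 := P.tMeasurable.mapFamily (f := (Sum.inl : S → S ⊕ T)) (hf := measurable_inl) H hH
  have h2 := Q.tMeasurable.mapFamily (f := (Sum.inr : T → S ⊕ T)) (hf := measurable_inr) H hH
  rw [← (MeasurableEquiv.sumProdDistrib S T unitInterval).symm.measurableSet_preimage]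
  exact measurableSet_sum_iff.2 ⟨h1, h2⟩

/-- The direct sum of two effectivity functions, on the disjoint union of the state spaces. -/
def directSum {S : Type u} {T : Type v} [MeasurableSpace S] [MeasurableSpace T]
    (P : EffFun S S) (Q : EffFun T T) : EffFun (S ⊕ T) (S ⊕ T) where
  portfolio := sumPortfolio P Q
  upper x := by
    cases x with
    | inl s => exact (P.upper s).mapFamily
    | inr t => exact (Q.upper t).mapFamily
  tMeasurable := isTMeasurable_sumPortfolio P Q

/-- `f` is a strong morphism from `P` to `Q`. -/
structure IsStrongMorphism {S : Type u} {T : Type v} [MeasurableSpace S] [MeasurableSpace T]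
    (P : EffFun S S) (Q : EffFun T T) (f : S → T) : Prop where
  measurable : Measurable f
  surjective : Function.Surjective f
  mem_iff : ∀ (s : S) (A : Set (SubProb S)), MeasurableSet A →
    (A ∈ P.portfolio s ↔ ∃ B ∈ Q.portfolio (f s), SubProb.map f measurable ⁻¹' B ⊆ A)

/-- `A` is closed under the relation `R`. -/
def IsRelClosed {S : Type u} (R : S → S → Prop) (A : Set S) : Prop :=
  ∀ x y, x ∈ A → R x y → y ∈ A

/-- The lift of `R` to subprobabilities: `μ` and `ν` agree on all measurable `R`-closed sets. -/
def liftRel {S : Type u} [MeasurableSpace S] (R : S → S → Prop) (μ ν : SubProb S) : Prop :=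
  ∀ A : Set S, MeasurableSet A → IsRelClosed R A → μ.1 A = ν.1 A

/-- `R` is a state bisimulation on the effectivity function `P`. -/
def IsStateBisimulation {S : Type u} [MeasurableSpace S] (P : EffFun S S)
    (R : S → S → Prop) : Prop :=
  (∀ s t, R s t → R t s) ∧
    ∀ s t, R s t → ∀ A ∈ P.portfolio s, ∃ B ∈ P.portfolio t, ∀ ν ∈ B, ∃ μ ∈ A, liftRel R μ ν

/-- The graph of `f : S → T`, as a relation on the disjoint union. -/
def graphRel {S : Type u} {T : Type v} (f : S → T) (x y : S ⊕ T) : Prop :=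
  ∃ s : S, x = Sum.inl s ∧ y = Sum.inr (f s)

end StochEff

namespace StochEff

/-! An `R`-closed `C` satisfies `s ∈ C ↔ f s ∈ C`, so `μ` and its image under `f` are always related
by the lifted relation. Given this, the morphism condition transports portfolio members both ways.
Passing from `S` to `T` also requires each `ν` to have a preimage under the image measure map: this
is `SubProb.map_surjective`, the only use of standard Borel spaces. To lift `ν`, write `S` as a
continuous image of the Baire space in a Polish topology that makes `f` continuous, and push `ν`
forward along a `ν`-a.e. measurable section of the composite (`exists_measurable_ae_section`). -/

/-- The sequences of natural numbers that start with the list `s`. -/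
def listCylinder (s : List ℕ) : Set (ℕ → ℕ) :=
  {x | (List.range s.length).map x = s}

theorem mem_listCylinder_append (s : List ℕ) (x : ℕ → ℕ) (hx : x ∈ listCylinder s) :
    x ∈ listCylinder (s ++ [x s.length]) := by
  simp only [listCylinder, mem_ofPred_eq] at hx ⊢
  simp [List.range_succ, hx]

theorem mem_listCylinder_map_range (x y : ℕ → ℕ) (k : ℕ) :
    y ∈ listCylinder ((List.range k).map x) ↔ ∀ i < k, y i = x i := by
  simp [listCylinder]

/-- Descending along a tree of measurable sets: there is a measurable map whose value at `t` is a
branch all of whose nodes contain `t`, provided `t` lies in the root and every node that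
contains `t` has a child that contains `t`. -/
theorem exists_measurable_branch {T : Type*} [MeasurableSpace T] (B : List ℕ → Set T)
    (hB : ∀ s, MeasurableSet (B s)) :
    ∃ h : T → ℕ → ℕ, Measurable h ∧ ∀ t, t ∈ B [] →
      (∀ s, t ∈ B s → ∃ n, t ∈ B (s ++ [n])) → ∀ k, t ∈ B ((List.range k).map (h t)) := by
  classical
  -- The second disjunct makes the least child total: at a dead end it is 0.
  let p : List ℕ → T → ℕ → Prop := fun s t n => t ∈ B (s ++ [n]) ∨ ∀ m, t ∉ B (s ++ [m])
  have hp : ∀ s t, ∃ n, p s t n := by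
    intro s t
    by_cases h : ∃ n, t ∈ B (s ++ [n])
    · exact h.imp fun n hn => Or.inl hn
    · exact ⟨0, Or.inr (not_exists.1 h)⟩
  let next : List ℕ → T → ℕ := fun s t => Nat.find (hp s t)
  have hnext : ∀ s, Measurable (next s) := by
    intro s
    refine measurable_find (hp s) fun n => ?_
    have : {t | p s t n} = B (s ++ [n]) ∪ ⋂ m, (B (s ++ [m]))ᶜ := by
      ext t
      simp [p]
    rw [this]
    exact (hB _).union (MeasurableSet.iInter fun m => (hB _).compl)
  let pre : T → ℕ → List ℕ := fun t k => Nat.rec [] (fun _ s => s ++ [next s t]) k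
  have hpre_succ : ∀ t k, pre t (k + 1) = pre t k ++ [next (pre t k) t] := fun _ _ => rfl
  -- Lists are countable and discrete, so joint measurability may be checked one list at a time.
  let _ : MeasurableSpace (List ℕ) := ⊤
  have hpre_meas : ∀ k, Measurable fun t => pre t k := by
    intro k
    induction k with
    | zero => exact measurable_const
    | succ k ih =>
      have h2 : Measurable fun q : T × List ℕ => q.2 ++ [next q.2 q.1] :=
        measurable_from_prod_countable_left fun s =>
          (measurable_from_top (f := fun n : ℕ => s ++ [n])).comp (hnext s)
      exact h2.comp (measurable_id.prodMk ih)
  have hnext_meas : ∀ k, Measurable fun t => next (pre t k) t := by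
    intro k
    have h2 : Measurable fun q : T × List ℕ => next q.2 q.1 :=
      measurable_from_prod_countable_left hnext
    exact h2.comp (measurable_id.prodMk (hpre_meas k))
  refine ⟨fun t k => next (pre t k) t, measurable_pi_iff.2 hnext_meas, ?_⟩
  intro t h0 hstep k
  have hpre : ∀ k, (List.range k).map (fun k => next (pre t k) t) = pre t k := by
    intro k
    induction k with
    | zero => rfl
    | succ k ih => rw [List.range_succ, List.map_append, ih]; rfl
  rw [hpre]
  induction k with
  | zero => exact h0
  | succ k ih =>
    rw [hpre_succ]
    rcases Nat.find_spec (hp (pre t k) t) with h | h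
    · exact h
    · obtain ⟨n, hn⟩ := hstep _ ih
      exact absurd hn (h n)

/-- A continuous surjection from the Baire space has a Borel section almost everywhere. -/
theorem exists_measurable_ae_section {T : Type*} [TopologicalSpace T] [T3Space T]
    [MeasurableSpace T] [BorelSpace T] (ν : Measure T) [IsFiniteMeasure ν] (g : (ℕ → ℕ) → T)
    (hg : Continuous g) (hsurj : Function.Surjective g) :
    ∃ h : T → ℕ → ℕ, Measurable h ∧ ∀ᵐ t ∂ν, g (h t) = t := by
  -- The images are only analytic. The measurable hull keeps their outer measure; the closure forces
  -- branches to converge.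
  let B : List ℕ → Set T := fun s =>
    toMeasurable ν (g '' listCylinder s) ∩ closure (g '' listCylinder s)
  have hB : ∀ s, MeasurableSet (B s) := fun s =>
    (measurableSet_toMeasurable _ _).inter isClosed_closure.measurableSet
  have hsub : ∀ s, g '' listCylinder s ⊆ B s := fun s =>
    subset_inter (subset_toMeasurable _ _) subset_closure
  obtain ⟨h, hm, hh⟩ := exists_measurable_branch B hB
  refine ⟨h, hm, ?_⟩
  have hnull : ∀ s, ∀ᵐ t ∂ν, t ∈ B s → ∃ n, t ∈ B (s ++ [n]) := by
    intro s
    have hU : MeasurableSet (⋃ n, B (s ++ [n])) := MeasurableSet.iUnion fun n => hB _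
    have hcover : g '' listCylinder s ⊆ ⋃ n, B (s ++ [n]) := by
      rintro _ ⟨x, hx, rfl⟩
      exact mem_iUnion.2 ⟨x s.length, hsub _ ⟨x, mem_listCylinder_append s x hx, rfl⟩⟩
    -- The union of the children contains the image, which already has the full measure of its hull;
    -- so almost no point of `B s` lacks a child.
    have hle : ν (B s) ≤ ν (B s ∩ ⋃ n, B (s ++ [n])) :=
      calc ν (B s) ≤ ν (toMeasurable ν (g '' listCylinder s)) := measure_mono inter_subset_left
        _ = ν (g '' listCylinder s) := measure_toMeasurable _
        _ ≤ _ := measure_mono (subset_inter (hsub s) hcover)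
    have h0 : ν (B s \ ⋃ n, B (s ++ [n])) = 0 := by
      have hadd := measure_inter_add_sdiff (μ := ν) (B s) hU
      have hfin : ν (B s ∩ ⋃ n, B (s ++ [n])) ≠ ⊤ := measure_ne_top _ _
      have h1 : ν (B s ∩ ⋃ n, B (s ++ [n])) + ν (B s \ ⋃ n, B (s ++ [n])) ≤
          ν (B s ∩ ⋃ n, B (s ++ [n])) + 0 := by
        rw [hadd, add_zero]
        exact hle
      exact le_antisymm ((ENNReal.add_le_add_iff_left hfin).1 h1) bot_le
    filter_upwards [measure_eq_zero_iff_ae_notMem.1 h0] with t ht hts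
    by_contra hcon
    exact ht ⟨hts, fun hu => hcon (mem_iUnion.1 hu)⟩
  filter_upwards [ae_all_iff.2 hnull] with t ht
  have hroot : t ∈ B [] := by
    obtain ⟨x, rfl⟩ := hsurj t
    exact hsub _ ⟨x, by simp [listCylinder], rfl⟩
  have hbranch := hh t hroot ht
  by_contra hne
  -- By continuity a short prefix of `h t` already confines `g` to `U`, yet `t` is in the closure of
  -- that cylinder's image, which must therefore meet `V`.
  obtain ⟨U, V, hU, hV, hgU, htV, hUV⟩ := t2_separation hne
  obtain ⟨k, hk⟩ : ∃ k, ∀ y : ℕ → ℕ, (∀ i < k, y i = h t i) → g y ∈ U := by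
    obtain ⟨I, u, hu, hIu⟩ := isOpen_pi_iff.1 (hU.preimage hg) (h t) hgU
    refine ⟨I.sup id + 1, fun y hy => hIu fun i hi => ?_⟩
    rw [hy i (Nat.lt_succ_of_le (Finset.le_sup (f := id) hi))]
    exact (hu i hi).2
  obtain ⟨_, hzV, y, hy, rfl⟩ := mem_closure_iff.1 (hbranch k).2 V hV htV
  exact disjoint_left.1 hUV (hk y ((mem_listCylinder_map_range _ _ _).1 hy)) hzV

/-- Finite measures lift along measurable surjections between standard Borel spaces. -/
theorem exists_measure_map_eq_of_surjective {S T : Type*} [MeasurableSpace S] [MeasurableSpace T]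
    [StandardBorelSpace S] [StandardBorelSpace T] {f : S → T} (hf : Measurable f)
    (hsurj : Function.Surjective f) (ν : Measure T) [IsFiniteMeasure ν] :
    ∃ μ : Measure S, μ.map f = ν := by
  rcases isEmpty_or_nonempty S with hS | hS
  · have : IsEmpty T := hsurj.isEmpty
    exact ⟨0, Subsingleton.elim _ _⟩
  let iS := upgradeStandardBorel S
  let := upgradeStandardBorel T
  obtain ⟨τ, hτ, hcont, hpol⟩ := hf.exists_continuous
  obtain ⟨φ, hφ, hφsurj⟩ := @PolishSpace.exists_nat_nat_continuous_surjective S τ hpol _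
  -- `τ` is finer than the chosen topology of `S`, whose Borel sets are the measurable sets.
  have hφ' : @Continuous _ _ _ iS.toTopologicalSpace φ := continuous_le_rng hτ hφ
  have hφm : Measurable φ := @Continuous.measurable _ _ _ _ _ iS.toTopologicalSpace _ _ _ hφ'
  obtain ⟨h, hm, hh⟩ := exists_measurable_ae_section ν (f ∘ φ) (hcont.comp hφ)
    (hsurj.comp hφsurj)
  refine ⟨ν.map (φ ∘ h), ?_⟩
  rw [Measure.map_map hf (hφm.comp hm), 
    Measure.map_congr (f := f ∘ φ ∘ h) (g := id) hh, Measure.map_id]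

theorem SubProb.map_surjective {S T : Type*} [MeasurableSpace S] [MeasurableSpace T]
    [StandardBorelSpace S] [StandardBorelSpace T] {f : S → T} (hf : Measurable f)
    (hsurj : Function.Surjective f) : Function.Surjective (SubProb.map f hf) := by
  intro ν
  have : IsFiniteMeasure ν.1 := ⟨ν.2.trans_lt ENNReal.one_lt_top⟩
  obtain ⟨μ, hμ⟩ := exists_measure_map_eq_of_surjective hf hsurj ν.1
  have hmass : μ univ ≤ 1 := by
    have h := ν.2
    rwa [← hμ, Measure.map_apply hf MeasurableSet.univ, preimage_univ] at h
  exact ⟨⟨μ, hmass⟩, Subtype.ext hμ⟩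

theorem SubProb.measurable_coe {S : Type*} [MeasurableSpace S] {A : Set S}
    (hA : MeasurableSet A) : Measurable fun μ : SubProb S => μ.1 A :=
  (Measure.measurable_coe hA).comp measurable_subtype_coe

/-- The restriction of a subprobability to a measurably embedded space. -/
noncomputable def SubProb.comap {S T : Type*} [MeasurableSpace S] [MeasurableSpace T]
    (i : S → T) (hi : MeasurableEmbedding i) (ν : SubProb T) : SubProb S :=
  ⟨ν.1.comap i, by
    rw [hi.comap_apply]
    exact (measure_mono (subset_univ _)).trans ν.2⟩

theorem SubProb.measurable_comap {S T : Type*} [MeasurableSpace S] [MeasurableSpace T]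
    {i : S → T} (hi : MeasurableEmbedding i) : Measurable (SubProb.comap i hi) := by
  refine Measurable.subtype_mk (Measure.measurable_of_measurable_coe _ fun A hA => ?_)
  simp only [hi.comap_apply]
  exact SubProb.measurable_coe (hi.measurableSet_image.2 hA)

theorem SubProb.comap_map {S T : Type*} [MeasurableSpace S] [MeasurableSpace T]
    {i : S → T} (hi : MeasurableEmbedding i) (μ : SubProb S) :
    SubProb.comap i hi (SubProb.map i hi.measurable μ) = μ :=
  Subtype.ext (hi.comap_map μ.1)

theorem SubProb.map_injective {S T : Type*} [MeasurableSpace S] [MeasurableSpace T]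
    {i : S → T} (hi : MeasurableEmbedding i) :
    Function.Injective (SubProb.map i hi.measurable) :=
  Function.LeftInverse.injective (SubProb.comap_map hi)

/-- The measures in the image are those that vanish off `range i` and whose `comap` lies in `A`;
both conditions are measurable. This makes images of portfolio members admissible in the direct sum.
-/
theorem SubProb.measurableSet_map_image {S T : Type*} [MeasurableSpace S] [MeasurableSpace T]
    {i : S → T} (hi : MeasurableEmbedding i) {A : Set (SubProb S)} (hA : MeasurableSet A) :
    MeasurableSet (SubProb.map i hi.measurable '' A) := by
  have : SubProb.map i hi.measurable '' A =
      SubProb.comap i hi ⁻¹' A ∩ {ν | ν.1 (range i)ᶜ = 0} := by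
    ext ν
    constructor
    · rintro ⟨μ, hμ, rfl⟩
      refine ⟨by rwa [mem_preimage, SubProb.comap_map], ?_⟩
      change μ.1.map i (range i)ᶜ = 0
      rw [hi.map_apply]
      simp
    · rintro ⟨hν, h0⟩
      refine ⟨_, hν, Subtype.ext ?_⟩
      change (ν.1.comap i).map i = ν.1
      rw [hi.map_comap]
      exact Measure.restrict_eq_self_of_ae_mem (mem_ae_iff.2 h0)
  rw [this]
  exact (SubProb.measurable_comap hi hA).inter
    (SubProb.measurable_coe hi.measurableSet_range.compl (measurableSet_singleton 0))

/-- The image of a portfolio member under a measurable embedding belongs to the image family. -/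
theorem map_image_mem_mapFamily {S T : Type*} [MeasurableSpace S] [MeasurableSpace T]
    {i : S → T} (hi : MeasurableEmbedding i) {V : Set (Set (SubProb S))} (hV : IsUpperFamily V)
    {A : Set (SubProb S)} (hA : A ∈ V) :
    SubProb.map i hi.measurable '' A ∈ mapFamily i hi.measurable V :=
  (mem_mapFamily_iff hV _).2
    ⟨SubProb.measurableSet_map_image hi (hV.1 _ hA), A, hA, Subset.rfl⟩

theorem measurableEmbedding_inl {S T : Type*} [MeasurableSpace S] [MeasurableSpace T] :
    MeasurableEmbedding (Sum.inl : S → S ⊕ T) :=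
  ⟨Sum.inl_injective, measurable_inl, fun _ hA => measurableSet_inl_image.2 hA⟩

theorem measurableEmbedding_inr {S T : Type*} [MeasurableSpace S] [MeasurableSpace T] :
    MeasurableEmbedding (Sum.inr : T → S ⊕ T) :=
  ⟨Sum.inr_injective, measurable_inr, fun _ hA => measurableSet_inr_image.2 hA⟩

/-- A subprobability on `S` and its image on `T` agree on the sets that are closed under the
graph of `f` and its converse. -/
theorem map_inl_apply_eq_map_inr_map_apply {S T : Type*} [MeasurableSpace S] [MeasurableSpace T]
    {f : S → T} (hf : Measurable f) (μ : SubProb S) {C : Set (S ⊕ T)} (hC : MeasurableSet C)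
    (hcl : IsRelClosed (fun x y => graphRel f x y ∨ graphRel f y x) C) :
    (SubProb.map Sum.inl measurable_inl μ).1 C =
      (SubProb.map Sum.inr measurable_inr (SubProb.map f hf μ)).1 C := by
  change μ.1.map Sum.inl C = (μ.1.map f).map Sum.inr C
  rw [Measure.map_apply measurable_inl hC, Measure.map_apply measurable_inr hC,
    Measure.map_apply hf (measurable_inr hC)]
  congr 1
  ext s
  exact ⟨fun h => hcl _ _ h (Or.inl ⟨s, rfl, rfl⟩), fun h => hcl _ _ h (Or.inr ⟨s, rfl, rfl⟩)⟩

end StochEff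

/-- The graph of a strong morphism between effectivity functions on standard Borel spaces,
together with its converse, is a state bisimulation on the direct sum. -/
theorem theoremp {S : Type*} {T : Type*} [MeasurableSpace S] [MeasurableSpace T]
    [StandardBorelSpace S] [StandardBorelSpace T]
    (P : StochEff.EffFun S S) (Q : StochEff.EffFun T T) (f : S → T)
    (hf : StochEff.IsStrongMorphism P Q f) :
    StochEff.IsStateBisimulation (StochEff.directSum P Q)
      (fun x y => StochEff.graphRel f x y ∨ StochEff.graphRel f y x) := by
  refine ⟨fun _ _ h => h.symm, ?_⟩
  rintro _ _ (⟨s, rfl, rfl⟩ | ⟨s, rfl, rfl⟩) A hA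
  · obtain ⟨B, hB, hBA⟩ :=
      (hf.mem_iff s _ (StochEff.SubProb.measurable_map _ measurable_inl hA.1)).1 hA.2
    refine ⟨_, StochEff.map_image_mem_mapFamily StochEff.measurableEmbedding_inr (Q.upper _) hB, ?_⟩
    rintro _ ⟨ν, hν, rfl⟩
    -- Any lift of `ν` will do, since the whole preimage of `B` lies in the given set.
    obtain ⟨μ, rfl⟩ := StochEff.SubProb.map_surjective hf.measurable hf.surjective ν
    exact ⟨_, hBA hν, fun C hC hcl =>
      StochEff.map_inl_apply_eq_map_inr_map_apply hf.measurable μ hC hcl⟩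
  -- In this direction the preimage of the given set is itself the witness, and no lifting is
  -- needed.
  · have hB := (hf.mem_iff s _ (StochEff.SubProb.measurable_map f hf.measurable
      (StochEff.SubProb.measurable_map _ measurable_inr hA.1))).2 ⟨_, hA.2, Subset.rfl⟩
    refine ⟨_, StochEff.map_image_mem_mapFamily StochEff.measurableEmbedding_inl (P.upper _) hB, ?_⟩
    rintro _ ⟨μ, hμ, rfl⟩
    exact ⟨_, hμ, fun C hC hcl =>
      (StochEff.map_inl_apply_eq_map_inr_map_apply hf.measurable μ hC hcl).symm⟩
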